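/- For nonnegative integers $m,n$ and $z_1,z_2\in\mathbb{C}$ let $$H_{m,n}(z_1,z_2)=\sum_{k=0}^{\min(m,n)}(-1)^k\,k!\binom{m}{k}\binom{n}{k}z_1^{m-k}z_2^{n-k}$$ be the complex (2D) Hermite polynomials. Let $W=(w_1,\dots,w_N)^T\in\mathbb{C}^N$ and let $H=(h_{m,n})_{m,n=1}^N$ be an $N\times N$ Hermitian matrix with Frobenius norm $\|H\|=\bigl(\sum_{m,n=1}^N|h_{m,n}|^2\bigr)^{1/2}<1$. Then $I_N+H$ is invertible and $$\det(I_N+H)^{-1}\exp\bigl(W^*H(I_N+H)^{-1}W\bigr)=\sum_{K}\Bigl(\prod_{1\le m,n\le N}\frac{h_{m,n}^{k_{m,n}}}{k_{m,n}!}\Bigr)\prod_{j=1}^{N}H_{r_j,c_j}(\overline{w_j},w_j),$$ where the sum runs over all $N\times N$ matrices $K=(k_{m,n})_{m,n=1}^N$ with nonnegative integer entries and converges unconditionally (equivalently, absolutely), $r_m=\sum_{\ell=1}^N k_{m,\ell}$ is the sum of row $m$ of $K$, and $c_n=\sum_{j=1}^N k_{j,n}$ is the sum of column $n$ of $K$.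 -/

import Mathlib

open scoped Matrix Matrix.Norms.Frobenius Nat

/-- The complex (2D) Hermite polynomial
`H_{m,n}(z₁, z₂) = ∑_{k=0}^{min(m,n)} (-1)^k k! C(m,k) C(n,k) z₁^{m-k} z₂^{n-k}`. -/
def hermite2D (m n : ℕ) (z₁ z₂ : ℂ) : ℂ :=
  ∑ k ∈ Finset.range (min m n + 1),
    (-1) ^ k * (k ! : ℂ) * (m.choose k : ℂ) * (n.choose k : ℂ) * z₁ ^ (m - k) * z₂ ^ (n - k)

/-- The sum `r_m` of the entries of `K` in row `m`. -/
def rowSum {N : ℕ} (K : Matrix (Fin N) (Fin N) ℕ) (m : Fin N) : ℕ := ∑ l, K m l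

/-- The sum `c_n` of the entries of `K` in column `n`. -/
def colSum {N : ℕ} (K : Matrix (Fin N) (Fin N) ℕ) (n : Fin N) : ℕ := ∑ j, K j n

open MeasureTheory Complex ComplexConjugate

/-! Each Hermite polynomial is a Gaussian moment: `π * hermite2D m n z₁ z₂` is the integral of `(z₁
+ I * conj ξ) ^ m * (z₂ + I * ξ) ^ n` against `exp (-‖ξ‖ ^ 2)`. Under the integral over `ℂ^N`, the
series in `K` is a product of exponential series, summing to the exponential of a form in `ξ`
(`hasSum_integral_gaussian`). Unitary diagonalisation of `H` splits the resulting integral into `N`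
planar Gaussians, which give the closed form (`integral_cexp_dotProduct_mulVec_mul_gaussian`). The
interchange is by dominated convergence, and this is where `‖H‖ < 1` is essential. -/

theorem summable_norm_and_hasSum_fin_prod {𝕜 κ : Type*} [NormedField 𝕜] [CompleteSpace 𝕜] {n : ℕ}
    (f : Fin n → κ → 𝕜) (hf : ∀ i, Summable fun k => ‖f i k‖) :
    Summable (fun k : Fin n → κ => ‖∏ i, f i (k i)‖) ∧
      HasSum (fun k : Fin n → κ => ∏ i, f i (k i)) (∏ i, ∑' k, f i k) := by
  induction n with
  | zero =>
    refine ⟨(hasSum_fintype _).summable, ?_⟩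
    simp
  | succ n ih =>
    obtain ⟨hs, hh⟩ := ih (fun i => f i.succ) (fun i => hf i.succ)
    have h0 := hf 0
    have hs' := h0.mul_norm hs
    have hmul := h0.of_norm.hasSum.mul hh hs'.of_norm
    rw [← (Fin.consEquiv (fun _ : Fin (n + 1) => κ)).summable_iff,
      ← (Fin.consEquiv (fun _ : Fin (n + 1) => κ)).hasSum_iff]
    have he : ∀ p : κ × (Fin n → κ),
        ∏ i, f i (Fin.consEquiv (fun _ : Fin (n + 1) => κ) p i) =
          f 0 p.1 * ∏ i : Fin n, f i.succ (p.2 i) := by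
      intro p
      simp [Fin.prod_univ_succ, Fin.consEquiv]
    simp only [Function.comp_def, he, Fin.prod_univ_succ (fun i => ∑' k, f i k)]
    exact ⟨hs', hmul⟩

theorem hasSum_matrix_prod_pow_div_factorial {𝕜 : Type*} [RCLike 𝕜] {M N : ℕ}
    (x : Matrix (Fin M) (Fin N) 𝕜) :
    HasSum (fun K : Matrix (Fin M) (Fin N) ℕ => ∏ m, ∏ n, x m n ^ K m n / ((K m n)! : 𝕜))
      (NormedSpace.exp (∑ m, ∑ n, x m n)) := by
  have hrow (m : Fin M) := summable_norm_and_hasSum_fin_prod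
    (fun n k => x m n ^ k / (k ! : 𝕜)) (fun n => NormedSpace.norm_expSeries_div_summable (x m n))
  have h := (summable_norm_and_hasSum_fin_prod
    (fun m (k : Fin N → ℕ) => ∏ n, x m n ^ k n / ((k n)! : 𝕜)) (fun m => (hrow m).1)).2
  convert! h using 1
  let _ : NormedAlgebra ℚ 𝕜 := NormedAlgebra.restrictScalars ℚ ℝ 𝕜
  rw [NormedSpace.exp_sum]
  refine Finset.prod_congr rfl fun m _ => ?_
  rw [(hrow m).2.tsum_eq, NormedSpace.exp_sum]
  refine Finset.prod_congr rfl fun n _ => ?_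
  rw [NormedSpace.exp_eq_tsum_div]

/-! ### Gaussian moments in the plane and Hermite polynomials -/

theorem integral_norm_pow_mul_exp_neg_sq (q : ℕ) :
    ∫ z : ℂ, ‖z‖ ^ q * Real.exp (-‖z‖ ^ 2) = Real.pi * Real.Gamma ((q + 2) / 2) := by
  have h := Complex.integral_rpow_mul_exp_neg_rpow (p := 2) (q := q) one_le_two
    (by have : (0 : ℝ) ≤ q := q.cast_nonneg
        linarith)
  simpa using h

theorem integrable_norm_pow_mul_exp_neg_sq (q : ℕ) :
    Integrable fun z : ℂ => ‖z‖ ^ q * Real.exp (-‖z‖ ^ 2) := by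
  -- The Bochner integral of a non-integrable function is `0`, so a nonzero value proves
  -- integrability.
  refine Integrable.of_integral_ne_zero ?_
  rw [integral_norm_pow_mul_exp_neg_sq]
  have : 0 < Real.Gamma (((q : ℝ) + 2) / 2) := Real.Gamma_pos_of_pos (by positivity)
  positivity

theorem integrable_conj_pow_mul_pow_mul_exp_neg_sq (a b : ℕ) :
    Integrable fun z : ℂ => conj z ^ a * z ^ b * (Real.exp (-‖z‖ ^ 2) : ℂ) := by
  refine (integrable_norm_pow_mul_exp_neg_sq (a + b)).mono'
    (Continuous.aestronglyMeasurable (by fun_prop)) (.of_forall fun z => ?_)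
  rw [norm_mul, norm_mul, norm_pow, norm_pow, RCLike.norm_conj, pow_add, Complex.norm_real,
    Real.norm_of_nonneg (Real.exp_nonneg _)]

theorem integral_conj_pow_mul_pow_mul_exp_neg_sq (a b : ℕ) :
    ∫ z : ℂ, conj z ^ a * z ^ b * (Real.exp (-‖z‖ ^ 2) : ℂ) =
      if a = b then (Real.pi : ℂ) * (a ! : ℂ) else 0 := by
  split_ifs with hab
  · subst hab
    have h (z : ℂ) : conj z ^ a * z ^ a * (Real.exp (-‖z‖ ^ 2) : ℂ) =
        ((‖z‖ ^ (2 * a) * Real.exp (-‖z‖ ^ 2) : ℝ) : ℂ) := by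
      rw [← mul_pow, Complex.conj_mul', ← pow_mul]
      push_cast
      ring
    simp_rw [h]
    rw [integral_complex_ofReal, integral_norm_pow_mul_exp_neg_sq]
    have : (((2 * a : ℕ) : ℝ) + 2) / 2 = a + 1 := by push_cast; ring
    rw [this, Real.Gamma_nat_eq_factorial]
    push_cast
    rfl
  · have hne : ((b : ℝ) - a) ≠ 0 := by
      rw [sub_ne_zero]
      exact_mod_cast Ne.symm hab
    -- Rotation by this angle multiplies the integrand by `exp (I * θ * (b - a)) = -1`, so the
    -- integral equals its own negative.
    set θ : ℝ := Real.pi / (b - a) with hθ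
    set c : Circle := Circle.exp θ
    have hc : conj (c : ℂ) ^ a * (c : ℂ) ^ b = -1 := by
      have h1 : (c : ℂ) = Complex.exp (θ * I) := Circle.coe_exp θ
      rw [h1, ← Complex.exp_conj, ← Complex.exp_nat_mul, ← Complex.exp_nat_mul, ← Complex.exp_add,
        ← Complex.exp_pi_mul_I]
      congr 1
      have h2 : Real.pi = θ * (b - a) := by rw [hθ]; field_simp
      have h3 : (Real.pi : ℂ) = θ * (b - a) := by exact_mod_cast congrArg (fun x : ℝ => (x : ℂ)) h2
      rw [h3]
      simp
      ring
    have h := (rotation c).measurePreserving.integral_comp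
      (rotation c).toHomeomorph.measurableEmbedding
      (fun z : ℂ => conj z ^ a * z ^ b * (Real.exp (-‖z‖ ^ 2) : ℂ))
    have h2 (z : ℂ) : conj (rotation c z) ^ a * (rotation c z) ^ b *
        (Real.exp (-‖rotation c z‖ ^ 2) : ℂ) =
        -1 * (conj z ^ a * z ^ b * (Real.exp (-‖z‖ ^ 2) : ℂ)) := by
      rw [LinearIsometryEquiv.norm_map, rotation_apply, map_mul, mul_pow, mul_pow, ← hc]
      ring
    simp_rw [h2] at h
    rw [integral_const_mul] at h
    linear_combination (-1 / 2 : ℂ) * h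

theorem integral_pow_mul_pow_eq_hermite2D (m n : ℕ) (z₁ z₂ : ℂ) :
    ∫ ξ : ℂ, (z₁ + I * conj ξ) ^ m * (z₂ + I * ξ) ^ n * (Real.exp (-‖ξ‖ ^ 2) : ℂ) =
      Real.pi * hermite2D m n z₁ z₂ := by
  have expand (ξ : ℂ) :
      (z₁ + I * conj ξ) ^ m * (z₂ + I * ξ) ^ n * (Real.exp (-‖ξ‖ ^ 2) : ℂ) =
      ∑ j ∈ Finset.range (m + 1), ∑ k ∈ Finset.range (n + 1),
        (I ^ (j + k) * m.choose j * n.choose k * z₁ ^ (m - j) * z₂ ^ (n - k)) *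
          (conj ξ ^ j * ξ ^ k * (Real.exp (-‖ξ‖ ^ 2) : ℂ)) := by
    rw [add_comm z₁, add_comm z₂, add_pow, add_pow, Finset.sum_mul_sum, Finset.sum_mul]
    refine Finset.sum_congr rfl fun j _ => ?_
    rw [Finset.sum_mul]
    refine Finset.sum_congr rfl fun k _ => ?_
    ring
  simp_rw [expand]
  rw [integral_finsetSum _ fun j _ => integrable_finsetSum _ fun k _ =>
    (integrable_conj_pow_mul_pow_mul_exp_neg_sq j k).const_mul _]
  simp_rw [integral_finsetSum (Finset.range (n + 1)) fun k _ =>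
    (integrable_conj_pow_mul_pow_mul_exp_neg_sq _ k).const_mul _, integral_const_mul,
    integral_conj_pow_mul_pow_mul_exp_neg_sq, mul_ite, mul_zero, Finset.sum_ite_eq,
    ← Finset.sum_filter]
  have hset : (Finset.range (m + 1)).filter (fun j => j ∈ Finset.range (n + 1)) =
      Finset.range (min m n + 1) := by
    ext j
    simp only [Finset.mem_filter, Finset.mem_range]
    omega
  rw [hset, hermite2D, Finset.mul_sum]
  refine Finset.sum_congr rfl fun k _ => ?_
  rw [← two_mul, pow_mul, I_sq]
  ring

/-! ### Gaussian integrals of Hermitian forms -/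

theorem integral_cexp_mul_exp_neg_sq {d : ℝ} (hd : -1 < d) (v : ℂ) :
    ∫ η : ℂ, Complex.exp (d * ((conj v + I * conj η) * (v + I * η))) * (Real.exp (-‖η‖ ^ 2) : ℂ) =
      Real.pi * ((1 + d : ℂ)⁻¹ * Complex.exp (conj v * (d * (1 + d : ℂ)⁻¹) * v)) := by
  have hb : 0 < ((1 + d : ℝ) : ℂ).re := by rw [ofReal_re]; linarith
  have hd0 : (1 + d : ℂ) ≠ 0 := by
    have : (1 + d : ℝ) ≠ 0 := by linarith
    exact_mod_cast this
  have h := GaussianFourier.integral_cexp_neg_mul_sq_norm_add hb (2 * I * d) v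
  have h1 (η : ℂ) :
      Complex.exp (d * ((conj v + I * conj η) * (v + I * η))) * (Real.exp (-‖η‖ ^ 2) : ℂ) =
      Complex.exp (d * (conj v * v)) *
        Complex.exp (-((1 + d : ℝ) : ℂ) * ‖η‖ ^ 2 + 2 * I * d * (inner ℝ v η : ℝ)) := by
    have h2 : (2 : ℂ) * (inner ℝ v η : ℝ) = conj v * η + conj η * v := by
      rw [Complex.inner]
      have := Complex.add_conj (conj v * η)
      rw [map_mul, Complex.conj_conj] at this
      push_cast at this
      rw [mul_comm (conj η), this, mul_comm η]
    rw [ofReal_exp, ← Complex.exp_add, ← Complex.exp_add]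
    congr 1
    push_cast
    rw [← Complex.conj_mul' η]
    linear_combination (-I * d) * h2 + d * conj η * η * I_sq
  simp_rw [h1]
  rw [integral_const_mul, h, Complex.finrank_real_complex]
  push_cast
  rw [div_self two_ne_zero, cpow_one, mul_left_comm, ← Complex.exp_add, ← Complex.conj_mul' v,
    div_eq_mul_inv, mul_assoc]
  congr 3
  field_simp
  linear_combination (4 * d ^ 2 * conj v * v) * I_sq

theorem measurePreserving_mulVec_of_mem_unitaryGroup {N : ℕ} {U : Matrix (Fin N) (Fin N) ℂ}
    (hU : U ∈ Matrix.unitaryGroup (Fin N) ℂ) :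
    MeasurePreserving (fun ξ : Fin N → ℂ => U *ᵥ ξ) := by
  set f : (Fin N → ℂ) →ₗ[ℝ] (Fin N → ℂ) := (Matrix.toLin' U).restrictScalars ℝ with hf
  -- The real determinant of a complex-linear map is the squared modulus of its complex determinant.
  have hdet : LinearMap.det f = 1 := by
    rw [hf, LinearMap.det_restrictScalars, LinearMap.det_toLin', Algebra.norm_complex_eq]
    have h := (Matrix.det_of_mem_unitary hU)
    rw [Unitary.mem_iff_self_mul_star, Complex.star_def, Complex.mul_conj] at h
    exact_mod_cast h
  have h := Measure.map_linearMap_addHaar_eq_smul_addHaar (volume : Measure (Fin N → ℂ))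
    (f := f) (by simp [hdet])
  refine ⟨by fun_prop, ?_⟩
  rw [hdet] at h
  change Measure.map f volume = volume
  simpa using h

theorem mul_diagonal_mul_star_mul {N : ℕ} {U : Matrix (Fin N) (Fin N) ℂ}
    (hU : U ∈ Matrix.unitaryGroup (Fin N) ℂ) (d e : Fin N → ℂ) :
    (U * Matrix.diagonal d * star U) * (U * Matrix.diagonal e * star U) =
      U * Matrix.diagonal (fun i => d i * e i) * star U := by
  rw [← Matrix.diagonal_mul_diagonal]
  simp only [Matrix.mul_assoc]
  rw [← Matrix.mul_assoc (star U) U, Matrix.mem_unitaryGroup_iff'.1 hU, Matrix.one_mul]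

theorem star_mulVec_dotProduct_mul_diagonal_mul_star_mulVec {N : ℕ}
    {U : Matrix (Fin N) (Fin N) ℂ} (hU : U ∈ Matrix.unitaryGroup (Fin N) ℂ) (d a b : Fin N → ℂ) :
    star (U *ᵥ a) ⬝ᵥ ((U * Matrix.diagonal d * star U) *ᵥ (U *ᵥ b)) =
      ∑ i, d i * (conj (a i) * b i) := by
  rw [Matrix.mulVec_mulVec, Matrix.mul_assoc, Matrix.mem_unitaryGroup_iff'.1 hU, Matrix.mul_one,
    ← Matrix.mulVec_mulVec, Matrix.star_mulVec, Matrix.dotProduct_mulVec, Matrix.vecMul_vecMul,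
    ← Matrix.star_eq_conjTranspose, Matrix.mem_unitaryGroup_iff'.1 hU, Matrix.vecMul_one]
  simp only [dotProduct, Matrix.mulVec_diagonal, Pi.star_apply, Complex.star_def]
  exact Finset.sum_congr rfl fun i _ => by ring

theorem prod_exp_neg_norm_sq {N : ℕ} (ξ : Fin N → ℂ) :
    ∏ j, (Real.exp (-‖ξ j‖ ^ 2) : ℂ) = Complex.exp (-(star ξ ⬝ᵥ ξ)) := by
  simp only [dotProduct, ← Finset.sum_neg_distrib, Complex.exp_sum, Pi.star_apply,
    Complex.star_def, Complex.conj_mul']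
  push_cast
  rfl

theorem integral_cexp_dotProduct_mulVec_mul_gaussian {N : ℕ} (W : Fin N → ℂ)
    {H : Matrix (Fin N) (Fin N) ℂ} (hH : H.IsHermitian) (hd : ∀ i, -1 < hH.eigenvalues i) :
    IsUnit (1 + H) ∧
    ∫ ξ : Fin N → ℂ, Complex.exp ((fun j => conj (W j) + I * conj (ξ j)) ⬝ᵥ
        (H *ᵥ fun j => W j + I * ξ j)) * ∏ j, (Real.exp (-‖ξ j‖ ^ 2) : ℂ) =
      (Real.pi : ℂ) ^ N *
        ((1 + H).det⁻¹ * Complex.exp (star W ⬝ᵥ ((H * (1 + H)⁻¹) *ᵥ W))) := by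
  obtain ⟨U, hU, hspec⟩ : ∃ U ∈ Matrix.unitaryGroup (Fin N) ℂ,
      H = U * Matrix.diagonal (fun i => (hH.eigenvalues i : ℂ)) * star U :=
    ⟨hH.eigenvectorUnitary, hH.eigenvectorUnitary.2, by
      conv_lhs => rw [hH.spectral_theorem, Unitary.conjStarAlgAut_apply]
      rfl⟩
  set d := hH.eigenvalues with hd_def
  have hd0 (i : Fin N) : (1 + d i : ℂ) ≠ 0 := by
    have : (1 + d i : ℝ) ≠ 0 := by linarith [hd i]
    exact_mod_cast this
  have hUU : star U * U = 1 := Matrix.mem_unitaryGroup_iff'.1 hU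
  have hUU' : U * star U = 1 := Matrix.mem_unitaryGroup_iff.1 hU
  have hone : U * Matrix.diagonal (fun _ => (1 : ℂ)) * star U = 1 := by
    rw [Matrix.diagonal_one, Matrix.mul_one, hUU']
  have hadd : 1 + H = U * Matrix.diagonal (fun i => (1 + d i : ℂ)) * star U := by
    rw [← Matrix.diagonal_add, Matrix.mul_add, Matrix.add_mul, hone, ← hspec]
  have hmul : (1 + H) * (U * Matrix.diagonal (fun i => (1 + d i : ℂ)⁻¹) * star U) = 1 := by
    rw [hadd, mul_diagonal_mul_star_mul hU]
    simp_rw [mul_inv_cancel₀ (hd0 _)]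
    exact hone
  have hinv := Matrix.inv_eq_right_inv hmul
  have hdet : (1 + H).det = ∏ i, (1 + d i : ℂ) := by
    rw [hadd, Matrix.det_mul, Matrix.det_mul, mul_right_comm, ← Matrix.det_mul, hUU',
      Matrix.det_one, one_mul, Matrix.det_diagonal]
  have hmulinv : H * (1 + H)⁻¹ =
      U * Matrix.diagonal (fun i => (d i * (1 + d i : ℂ)⁻¹)) * star U := by
    rw [hinv]
    conv_lhs => rw [hspec]
    rw [mul_diagonal_mul_star_mul hU]
  refine ⟨(Matrix.isUnit_iff_isUnit_det _).2 ?_, ?_⟩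
  · rw [hdet, isUnit_iff_ne_zero]
    exact Finset.prod_ne_zero_iff.2 fun i _ => hd0 i
  set V := star U *ᵥ W with hV
  have hW : W = U *ᵥ V := by rw [hV, Matrix.mulVec_mulVec, hUU', Matrix.one_mulVec]
  have hmp := measurePreserving_mulVec_of_mem_unitaryGroup hU
  rw [← hmp.map_eq, integral_map hmp.measurable.aemeasurable
    (Continuous.aestronglyMeasurable (by fun_prop))]
  have key (η : Fin N → ℂ) :
      Complex.exp ((fun j => conj (W j) + I * conj ((U *ᵥ η) j)) ⬝ᵥ
        (H *ᵥ fun j => W j + I * (U *ᵥ η) j)) * ∏ j, (Real.exp (-‖(U *ᵥ η) j‖ ^ 2) : ℂ) =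
      ∏ j, (Complex.exp (d j * ((conj (V j) + I * conj (η j)) * (V j + I * η j))) *
        (Real.exp (-‖η j‖ ^ 2) : ℂ)) := by
    -- The two vectors are not conjugate to each other: `star` flips the sign of `I`, hence `V - I •
    -- η` here and `V + I • η` below.
    have hx : (fun j => conj (W j) + I * conj ((U *ᵥ η) j)) = star (U *ᵥ (V - I • η)) := by
      rw [Matrix.mulVec_sub, Matrix.mulVec_smul, ← hW]
      funext j
      simp
    have hy : (fun j => W j + I * (U *ᵥ η) j) = U *ᵥ (V + I • η) := by
      rw [Matrix.mulVec_add, Matrix.mulVec_smul, ← hW]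
      rfl
    have hnorm : star (U *ᵥ η) ⬝ᵥ (U *ᵥ η) = star η ⬝ᵥ η := by
      rw [Matrix.star_mulVec, Matrix.dotProduct_mulVec, Matrix.vecMul_vecMul,
        ← Matrix.star_eq_conjTranspose, hUU, Matrix.vecMul_one]
    rw [Finset.prod_mul_distrib, prod_exp_neg_norm_sq, hnorm, ← prod_exp_neg_norm_sq, hx, hy]
    conv_lhs => rw [hspec]
    rw [star_mulVec_dotProduct_mul_diagonal_mul_star_mulVec hU, Complex.exp_sum]
    simp
  simp_rw [key]
  rw [integral_fintype_prod_volume_eq_prod (fun (j : Fin N) (η : ℂ) =>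
    Complex.exp (d j * ((conj (V j) + I * conj η) * (V j + I * η))) *
        (Real.exp (-‖η‖ ^ 2) : ℂ))]
  simp_rw [integral_cexp_mul_exp_neg_sq (hd _)]
  rw [Finset.prod_mul_distrib, Finset.prod_mul_distrib, hdet, hmulinv]
  conv_rhs => rw [hW, star_mulVec_dotProduct_mul_diagonal_mul_star_mulVec hU, Complex.exp_sum]
  simp only [Finset.prod_const, Finset.card_univ, Fintype.card_fin, Finset.prod_inv_distrib]
  congr 2
  refine Finset.prod_congr rfl fun i _ => ?_
  congr 1
  ring

/-! ### Frobenius-norm bounds and domination -/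

theorem frobenius_norm_sq_eq_sum {M N : ℕ} (A : Matrix (Fin M) (Fin N) ℂ) :
    ‖A‖ ^ 2 = ∑ m, ∑ n, ‖A m n‖ ^ 2 := by
  rw [Matrix.frobenius_norm_def, ← Real.sqrt_eq_rpow, Real.sq_sqrt (by positivity)]
  simp

/-- Cauchy–Schwarz over pairs of indices. Because the entries appear in absolute value, the spectral
norm of `A` would not do. -/
theorem sum_norm_mul_le_frobenius_norm_mul {N : ℕ} (A : Matrix (Fin N) (Fin N) ℂ)
    (a : Fin N → ℝ) :
    ∑ m, ∑ n, ‖A m n‖ * (a m * a n) ≤ ‖A‖ * ∑ j, a j ^ 2 := by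
  refine le_of_sq_le_sq ?_ (by positivity)
  have h := Finset.sum_mul_sq_le_sq_mul_sq (Finset.univ : Finset (Fin N × Fin N))
    (fun p => ‖A p.1 p.2‖) (fun p => a p.1 * a p.2)
  simp only [Fintype.sum_prod_type] at h
  refine h.trans_eq ?_
  have h2 : (∑ j, a j ^ 2) ^ 2 = ∑ m, ∑ n, (a m * a n) ^ 2 := by
    rw [sq, Finset.sum_mul_sum]
    simp_rw [mul_pow]
  rw [mul_pow, frobenius_norm_sq_eq_sum, h2]

theorem Matrix.IsHermitian.abs_eigenvalues_le_frobenius_norm {N : ℕ}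
    {H : Matrix (Fin N) (Fin N) ℂ} (hH : H.IsHermitian) (i : Fin N) :
    |hH.eigenvalues i| ≤ ‖H‖ := by
  set v := hH.eigenvectorBasis i
  have hv : ∑ j, ‖v j‖ ^ 2 = 1 := by
    rw [← EuclideanSpace.norm_sq_eq, hH.eigenvectorBasis.norm_eq_one i, one_pow]
  rw [hH.eigenvalues_eq i]
  refine (Complex.abs_re_le_norm _).trans ?_
  refine le_trans ?_ ((sum_norm_mul_le_frobenius_norm_mul H fun j => ‖v j‖).trans_eq
    (by rw [hv, mul_one]))
  simp only [dotProduct, Matrix.mulVec]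
  refine (norm_sum_le _ _).trans (Finset.sum_le_sum fun m _ => ?_)
  rw [norm_mul, Pi.star_apply, norm_star]
  refine (mul_le_mul_of_nonneg_left (norm_sum_le Finset.univ fun n => H m n * v n)
    (norm_nonneg _)).trans_eq ?_
  rw [Finset.mul_sum]
  refine Finset.sum_congr rfl fun n _ => ?_
  rw [norm_mul]
  ring

theorem integrable_exp_mul_add_norm_sq_sub_norm_sq {ρ : ℝ} (hρ : ρ < 1) (a : ℝ) :
    Integrable fun z : ℂ => Real.exp (ρ * (a + ‖z‖) ^ 2 - ‖z‖ ^ 2) := by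
  -- Half of the decay rate `1 - ρ` is kept; the other half absorbs the cross term `2 * ρ * a * ‖z‖`
  -- by completing the square.
  set δ := (1 - ρ) / 2 with hδ
  have hδ0 : 0 < δ := by rw [hδ]; linarith
  have hint : Integrable fun z : ℂ => Real.exp (-δ * ‖z‖ ^ 2) := by
    refine Integrable.of_integral_ne_zero ?_
    rw [GaussianFourier.integral_rexp_neg_mul_sq_norm hδ0]
    positivity
  refine (hint.const_mul (Real.exp (ρ * a ^ 2 + (ρ * a) ^ 2 / δ))).mono'
    (Continuous.aestronglyMeasurable (by fun_prop)) (.of_forall fun z => ?_)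
  rw [Real.norm_of_nonneg (Real.exp_nonneg _), ← Real.exp_add, Real.exp_le_exp]
  have h : 0 ≤ (δ * ‖z‖ - ρ * a) ^ 2 / δ := by positivity
  have h2 : (δ * ‖z‖ - ρ * a) ^ 2 / δ = δ * ‖z‖ ^ 2 - 2 * (ρ * a) * ‖z‖ + (ρ * a) ^ 2 / δ := by
    field_simp
    ring
  have h3 : ρ = 1 - 2 * δ := by rw [hδ]; ring
  rw [h2] at h
  have h4 : ρ * ‖z‖ ^ 2 = ‖z‖ ^ 2 - 2 * δ * ‖z‖ ^ 2 := by
    conv_lhs => rw [h3]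
    ring
  nlinarith

theorem prod_mul_mul_pow_div_factorial {𝕜 : Type*} [Field 𝕜] {N : ℕ}
    (A : Matrix (Fin N) (Fin N) 𝕜) (x y : Fin N → 𝕜) (K : Matrix (Fin N) (Fin N) ℕ) :
    ∏ m, ∏ n, (A m n * (x m * y n)) ^ K m n / ((K m n)! : 𝕜) =
      (∏ m, ∏ n, A m n ^ K m n / ((K m n)! : 𝕜)) *
        ∏ j, (x j ^ rowSum K j * y j ^ colSum K j) := by
  have h (m n : Fin N) : (A m n * (x m * y n)) ^ K m n / ((K m n)! : 𝕜) =
      (A m n ^ K m n / ((K m n)! : 𝕜)) * (x m ^ K m n * y n ^ K m n) := by ring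
  simp_rw [h, Finset.prod_mul_distrib]
  congr 2
  · simp_rw [rowSum, Finset.prod_pow_eq_pow_sum]
  · rw [Finset.prod_comm]
    simp_rw [colSum, Finset.prod_pow_eq_pow_sum]

/-- This is the sum of the absolute values of all terms of the series, hence the dominating function
for the interchange. -/
theorem integrable_exp_sum_norm_mul_gaussian {N : ℕ} (W : Fin N → ℂ)
    {H : Matrix (Fin N) (Fin N) ℂ} (hnorm : ‖H‖ < 1) :
    Integrable fun ξ : Fin N → ℂ => Real.exp (∑ m, ∑ n, ‖H m n *
      ((conj (W m) + I * conj (ξ m)) * (W n + I * ξ n))‖) * ∏ j, Real.exp (-‖ξ j‖ ^ 2) := by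
  refine (Integrable.fintype_prod (fun j : Fin N =>
    integrable_exp_mul_add_norm_sq_sub_norm_sq hnorm ‖W j‖)).mono'
    (Continuous.aestronglyMeasurable (by fun_prop)) (.of_forall fun ξ => ?_)
  have hx (m : Fin N) : ‖conj (W m) + I * conj (ξ m)‖ ≤ ‖W m‖ + ‖ξ m‖ :=
    (norm_add_le _ _).trans_eq (by simp)
  have hy (m : Fin N) : ‖W m + I * ξ m‖ ≤ ‖W m‖ + ‖ξ m‖ :=
    (norm_add_le _ _).trans_eq (by simp)
  rw [Real.norm_of_nonneg (by positivity), ← Real.exp_sum, ← Real.exp_sum, ← Real.exp_add,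
    Real.exp_le_exp, Finset.sum_sub_distrib, ← Finset.mul_sum, Finset.sum_neg_distrib,
    ← sub_eq_add_neg]
  refine sub_le_sub_right (le_trans ?_
    (sum_norm_mul_le_frobenius_norm_mul H fun j => ‖W j‖ + ‖ξ j‖)) _
  refine Finset.sum_le_sum fun m _ => Finset.sum_le_sum fun n _ => ?_
  rw [norm_mul, norm_mul]
  exact mul_le_mul_of_nonneg_left
    (mul_le_mul (hx m) (hy n) (norm_nonneg _) (by positivity)) (norm_nonneg _)

/-! ### Termwise integration -/

theorem hasSum_integral_gaussian {N : ℕ} (W : Fin N → ℂ)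
    {H : Matrix (Fin N) (Fin N) ℂ} (hnorm : ‖H‖ < 1) :
    HasSum (fun K : Matrix (Fin N) (Fin N) ℕ => ∫ ξ : Fin N → ℂ,
        (∏ m, ∏ n, (H m n * ((conj (W m) + I * conj (ξ m)) * (W n + I * ξ n))) ^ K m n /
          ((K m n)! : ℂ)) * ∏ j, (Real.exp (-‖ξ j‖ ^ 2) : ℂ))
      (∫ ξ : Fin N → ℂ, Complex.exp ((fun j => conj (W j) + I * conj (ξ j)) ⬝ᵥ
        (H *ᵥ fun j => W j + I * ξ j)) * ∏ j, (Real.exp (-‖ξ j‖ ^ 2) : ℂ)) := by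
  have hbound (ξ : Fin N → ℂ) := (hasSum_matrix_prod_pow_div_factorial fun m n => ‖H m n *
      ((conj (W m) + I * conj (ξ m)) * (W n + I * ξ n))‖).mul_right
        (∏ j, Real.exp (-‖ξ j‖ ^ 2))
  have : Countable (Matrix (Fin N) (Fin N) ℕ) :=
    inferInstanceAs (Countable (Fin N → Fin N → ℕ))
  refine hasSum_integral_of_dominated_convergence
    (fun K ξ => (∏ m, ∏ n, ‖H m n * ((conj (W m) + I * conj (ξ m)) * (W n + I * ξ n))‖ ^ K m n /
      ((K m n)! : ℝ)) * ∏ j, Real.exp (-‖ξ j‖ ^ 2))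
    (fun K => Continuous.aestronglyMeasurable (by fun_prop))
    (fun K => .of_forall fun ξ => ?_) (.of_forall fun ξ => (hbound ξ).summable) ?_
    (.of_forall fun ξ => ?_)
  · simp [norm_prod, -Complex.ofReal_exp]
  · simp_rw [fun ξ => (hbound ξ).tsum_eq, ← Real.exp_eq_exp_ℝ]
    exact integrable_exp_sum_norm_mul_gaussian W hnorm
  · refine HasSum.mul_right _ ?_
    convert! hasSum_matrix_prod_pow_div_factorial fun m n => H m n *
      ((conj (W m) + I * conj (ξ m)) * (W n + I * ξ n)) using 1
    rw [← Complex.exp_eq_exp_ℂ]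
    congr 1
    simp only [dotProduct, Matrix.mulVec, Finset.mul_sum]
    exact Finset.sum_congr rfl fun m _ => Finset.sum_congr rfl fun n _ => by ring

theorem integral_prod_pow_div_factorial_mul_gaussian {N : ℕ} (W : Fin N → ℂ)
    (H : Matrix (Fin N) (Fin N) ℂ) (K : Matrix (Fin N) (Fin N) ℕ) :
    ∫ ξ : Fin N → ℂ,
        (∏ m, ∏ n, (H m n * ((conj (W m) + I * conj (ξ m)) * (W n + I * ξ n))) ^ K m n /
          ((K m n)! : ℂ)) * ∏ j, (Real.exp (-‖ξ j‖ ^ 2) : ℂ) =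
      (Real.pi : ℂ) ^ N * ((∏ m, ∏ n, H m n ^ K m n / ((K m n)! : ℂ)) *
          ∏ j, hermite2D (rowSum K j) (colSum K j) (star (W j)) (W j)) := by
  have h (ξ : Fin N → ℂ) := prod_mul_mul_pow_div_factorial H
    (fun j => conj (W j) + I * conj (ξ j)) (fun j => W j + I * ξ j) K
  have h2 (ξ : Fin N → ℂ) :
      (∏ m, ∏ n, (H m n * ((conj (W m) + I * conj (ξ m)) * (W n + I * ξ n))) ^ K m n /
          ((K m n)! : ℂ)) * ∏ j, (Real.exp (-‖ξ j‖ ^ 2) : ℂ) =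
        (∏ m, ∏ n, H m n ^ K m n / ((K m n)! : ℂ)) *
          ∏ j, ((conj (W j) + I * conj (ξ j)) ^ rowSum K j * (W j + I * ξ j) ^ colSum K j *
            (Real.exp (-‖ξ j‖ ^ 2) : ℂ)) := by
    rw [h, mul_assoc, ← Finset.prod_mul_distrib]
  simp_rw [h2]
  rw [integral_const_mul, integral_fintype_prod_volume_eq_prod (fun (j : Fin N) (ξ : ℂ) =>
    (conj (W j) + I * conj ξ) ^ rowSum K j * (W j + I * ξ) ^ colSum K j *
      (Real.exp (-‖ξ‖ ^ 2) : ℂ))]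
  simp_rw [integral_pow_mul_pow_eq_hermite2D]
  rw [Finset.prod_mul_distrib, Finset.prod_const, Finset.card_univ, Fintype.card_fin]
  simp only [Complex.star_def]
  ring

theorem theorem1p2 (N : ℕ) (W : Fin N → ℂ) (H : Matrix (Fin N) (Fin N) ℂ)
    (hH : H.IsHermitian) (hnorm : ‖H‖ < 1) :
    IsUnit (1 + H) ∧
    HasSum
      (fun K : Matrix (Fin N) (Fin N) ℕ =>
        (∏ m, ∏ n, H m n ^ K m n / ((K m n)! : ℂ)) *
          ∏ j, hermite2D (rowSum K j) (colSum K j) (star (W j)) (W j))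
      ((1 + H).det⁻¹ * Complex.exp (star W ⬝ᵥ ((H * (1 + H)⁻¹) *ᵥ W))) := by
  have hd (i : Fin N) : -1 < hH.eigenvalues i := by
    linarith [neg_le_of_abs_le (hH.abs_eigenvalues_le_frobenius_norm i)]
  obtain ⟨hunit, hint⟩ := integral_cexp_dotProduct_mulVec_mul_gaussian W hH hd
  refine ⟨hunit, ?_⟩
  have h := hasSum_integral_gaussian W hnorm
  rw [hint] at h
  simp_rw [integral_prod_pow_div_factorial_mul_gaussian] at h
  exact (hasSum_mul_left_iff (pow_ne_zero N (by exact_mod_cast Real.pi_ne_zero))).1 h
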